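/- For a real function $f$ on $(0,\pi/2)$ such that $f(x)\log(\tan x)$ is integrable there, put $L(f)=\int_0^{\pi/2} f(x)\log(\tan x)\,dx$. For $n\ge 0$ let $\tilde P_n$ be the shifted Legendre polynomial on $[0,\pi/2]$, $$\tilde P_n(x)=\frac{(-1)^n}{n!}\left(\frac{2}{\pi}\right)^n\frac{d^n}{dx^n}\left[x^n\left(\frac{\pi}{2}-x\right)^n\right].$$ Then the function $x\mapsto\log(\tan x)$ belongs to $L^2(0,\pi/2)$ and $$\log(\tan x)=\frac{2}{\pi}\sum_{n=1}^{\infty}(4n-1)\,L(\tilde P_{2n-1})\,\tilde P_{2n-1}(x),$$ where the series converges unconditionally in $L^2(0,\pi/2)$. Moreover, $$\sum_{n=1}^{\infty}(4n-1)\left[L(\tilde P_{2n-1})\right]^2=\left(\frac{\pi}{2}\right)^4 .$$ -/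

import Mathlib

open MeasureTheory Real
open scoped Polynomial Nat

noncomputable section

/-- The log-tangent integral `L(f) = ∫₀^{π/2} f(x) log(tan x) dx`. -/
def logTanIntegral (f : ℝ → ℝ) : ℝ :=
  ∫ x in (0 : ℝ)..(π / 2), f x * Real.log (Real.tan x)

/-- The Legendre polynomial shifted to `[0, π/2]`, by the Rodrigues formula
`((-1)^n / n!) (2/π)^n (d/dx)^n [x^n (π/2 - x)^n]`. -/
def legendreHalfPi (n : ℕ) : ℝ[X] :=
  Polynomial.C ((-1 : ℝ) ^ n / (n ! : ℝ) * (2 / π) ^ n) *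
    Polynomial.derivative^[n] (Polynomial.X ^ n * (Polynomial.C (π / 2) - Polynomial.X) ^ n)

/-- The polynomial function of `legendreHalfPi n`. -/
def legendreFun (n : ℕ) (x : ℝ) : ℝ := (legendreHalfPi n).eval x

/-- Lebesgue measure on `(0, π/2)`. -/
def halfPiMeasure : Measure ℝ := volume.restrict (Set.Ioo 0 (π / 2))

end

/-! The normalized shifted Legendre polynomials form a Hilbert basis of `L²(0, π/2)`: orthonormality
comes from the Rodrigues formula by repeated integration by parts, completeness from Weierstrass
approximation (`legendreBasis`). The two claims are the basis expansion of `log ∘ tan` and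
Parseval's identity. Reflection about `π/4` negates `log ∘ tan` and multiplies the `n`-th polynomial
by `(-1)^n`, so only odd indices contribute. Parseval needs the norm: with `t = tan x`, each half of
the interval contributes `∫₀¹ log² t / (1 + t²) dt = 2 β(3) = π³/16`, where `β` is the Dirichlet
beta function. -/

/-! ### The `L²` norm of `log ∘ tan`. -/

/-- An antiderivative of `t ^ m * (log t) ^ 2`. -/
noncomputable def powMulLogSqPrimitive (m : ℕ) (t : ℝ) : ℝ :=
  t ^ m * (t * log t ^ 2 / (m + 1) - 2 * (t * log t) / (m + 1) ^ 2 + 2 * t / (m + 1) ^ 3)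

lemma continuousOn_mul_log_sq : ContinuousOn (fun t : ℝ => t * log t ^ 2) (Set.Ici 0) := by
  -- Writing `t = (√t)²` reduces the claim to continuity of `s log s` at `0`.
  have h : Continuous (fun t : ℝ => 4 * (√t * log √t) ^ 2) :=
    continuous_const.mul ((continuous_mul_log.comp continuous_sqrt).pow 2)
  refine h.continuousOn.congr fun t ht => ?_
  have ht : 0 ≤ t := ht
  simp only [log_sqrt ht, mul_pow, sq_sqrt ht]
  ring

lemma continuousOn_powMulLogSqPrimitive (m : ℕ) :
    ContinuousOn (powMulLogSqPrimitive m) (Set.Icc 0 1) := by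
  unfold powMulLogSqPrimitive
  have h1 : ContinuousOn (fun t : ℝ => t * log t ^ 2) (Set.Icc 0 1) :=
    continuousOn_mul_log_sq.mono Set.Icc_subset_Ici_self
  have h2 : ContinuousOn (fun t : ℝ => t * log t) (Set.Icc 0 1) := continuous_mul_log.continuousOn
  fun_prop

lemma hasDerivAt_powMulLogSqPrimitive (m : ℕ) {t : ℝ} (ht : 0 < t) :
    HasDerivAt (powMulLogSqPrimitive m) (t ^ m * log t ^ 2) t := by
  have hl := hasDerivAt_log ht.ne'
  have hi := hasDerivAt_id' t
  have h := (hasDerivAt_pow m t).mul ((((hi.mul (hl.pow 2)).div_const ((m : ℝ) + 1)).sub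
    (((hi.mul hl).const_mul 2).div_const (((m : ℝ) + 1) ^ 2))).add
    ((hi.const_mul 2).div_const (((m : ℝ) + 1) ^ 3)))
  refine h.congr_deriv ?_
  have hm : (m : ℝ) + 1 ≠ 0 := by positivity
  have ht' := ht.ne'
  rcases m with _ | m
  · simp
    field_simp
    ring
  · simp
    field_simp
    ring

lemma intervalIntegrable_pow_mul_log_sq (m : ℕ) :
    IntervalIntegrable (fun t : ℝ => t ^ m * log t ^ 2) volume 0 1 := by
  rw [intervalIntegrable_iff_integrableOn_Ioc_of_le zero_le_one]
  exact intervalIntegral.integrableOn_deriv_of_nonneg (continuousOn_powMulLogSqPrimitive m)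
    (fun x hx => hasDerivAt_powMulLogSqPrimitive m hx.1)
    (fun x hx => mul_nonneg (pow_nonneg hx.1.le _) (sq_nonneg _))

lemma integral_pow_mul_log_sq (m : ℕ) :
    ∫ t in (0 : ℝ)..1, t ^ m * log t ^ 2 = 2 / ((m : ℝ) + 1) ^ 3 := by
  rw [intervalIntegral.integral_eq_sub_of_hasDerivAt_of_le zero_le_one
    (continuousOn_powMulLogSqPrimitive m) (fun x hx => hasDerivAt_powMulLogSqPrimitive m hx.1)
    (intervalIntegrable_pow_mul_log_sq m)]
  simp [powMulLogSqPrimitive]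

/-- The value of the Dirichlet beta function at `3`. -/
lemma hasSum_neg_one_pow_div_odd_cube :
    HasSum (fun k : ℕ => (-1 : ℝ) ^ k / (2 * (k : ℝ) + 1) ^ 3) (π ^ 3 / 32) := by
  -- Fourier series of the Bernoulli polynomial `B₃` at `1/4`: `sin (π n / 2)` is `0` for even `n`
  -- and `(-1)^k` for `n = 2k + 1`.
  have h := hasSum_one_div_nat_pow_mul_sin one_ne_zero (x := 1 / 4) (by norm_num)
  have hb : Polynomial.eval (1 / 4 : ℝ)
      (Polynomial.map (algebraMap ℚ ℝ) (Polynomial.bernoulli (2 * 1 + 1))) = 3 / 64 := by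
    rw [Polynomial.bernoulli_def]
    simp [Finset.sum_range_succ, bernoulli_eq_bernoulli'_of_ne_one]
    norm_num [bernoulli_one, Nat.choose]
  rw [hb] at h
  have hinj : Function.Injective (fun k : ℕ => 2 * k + 1) := fun a b h => by
    simpa using h
  rw [← hinj.hasSum_iff] at h
  · convert h using 1
    · ext k
      have : 2 * π * ((2 * k + 1 : ℕ) : ℝ) * (1 / 4) = π / 2 + k * π := by push_cast; ring
      simp only [Function.comp, this, sin_add_nat_mul_pi, sin_pi_div_two]
      push_cast
      ring
    · norm_num [Nat.factorial]
      ring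
  · intro n hn
    have he : Even n := by
      by_contra ho
      obtain ⟨k, hk⟩ := Nat.not_even_iff_odd.1 ho
      exact hn ⟨k, hk.symm⟩
    obtain ⟨k, rfl⟩ := he
    have : 2 * π * ((k + k : ℕ) : ℝ) * (1 / 4) = k * π := by push_cast; ring
    rw [this, sin_nat_mul_pi, mul_zero]

lemma integrableOn_log_sq_div :
    IntegrableOn (fun t : ℝ => log t ^ 2 / (1 + t ^ 2)) (Set.Ioo 0 1) := by
  have h : IntegrableOn (fun t : ℝ => t ^ 0 * log t ^ 2) (Set.Ioo 0 1) :=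
    ((intervalIntegrable_iff_integrableOn_Ioc_of_le zero_le_one).1
      (intervalIntegrable_pow_mul_log_sq 0)).mono_set Set.Ioo_subset_Ioc_self
  have hm : Measurable fun t : ℝ => log t ^ 2 / (1 + t ^ 2) := by fun_prop
  refine Integrable.mono h hm.aestronglyMeasurable (Filter.Eventually.of_forall fun t => ?_)
  rw [norm_of_nonneg (by positivity), norm_of_nonneg (by positivity), pow_zero, one_mul]
  exact div_le_self (sq_nonneg _) (by nlinarith [sq_nonneg t])

lemma integral_log_sq_div :
    ∫ t in Set.Ioo (0 : ℝ) 1, log t ^ 2 / (1 + t ^ 2) = π ^ 3 / 16 := by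
  have hval (k : ℕ) : ∫ t in Set.Ioo (0 : ℝ) 1, t ^ (2 * k) * log t ^ 2
      = 2 / (2 * (k : ℝ) + 1) ^ 3 := by
    rw [← integral_Ioc_eq_integral_Ioo, ← intervalIntegral.integral_of_le zero_le_one,
      integral_pow_mul_log_sq]
    push_cast
    rfl
  have hint (k : ℕ) : IntegrableOn (fun t : ℝ => t ^ (2 * k) * log t ^ 2) (Set.Ioo 0 1) :=
    ((intervalIntegrable_iff_integrableOn_Ioc_of_le zero_le_one).1
      (intervalIntegrable_pow_mul_log_sq _)).mono_set Set.Ioo_subset_Ioc_self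
  -- Termwise integration of the geometric series for `1 / (1 + t²)`; the norms integrate to `2 /
  -- (2k + 1)³`, which is summable.
  have hsum := hasSum_integral_of_summable_integral_norm (μ := volume.restrict (Set.Ioo (0 : ℝ) 1))
    (F := fun (k : ℕ) t => (-1 : ℝ) ^ k * (t ^ (2 * k) * log t ^ 2))
    (fun k => (hint k).const_mul _) ?_
  · have h2 := hasSum_neg_one_pow_div_odd_cube.mul_left 2
    have : (fun k : ℕ => ∫ t in Set.Ioo (0 : ℝ) 1, (-1 : ℝ) ^ k * (t ^ (2 * k) * log t ^ 2))
        = fun k : ℕ => 2 * ((-1 : ℝ) ^ k / (2 * (k : ℝ) + 1) ^ 3) := by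
      ext k
      rw [integral_const_mul, hval]
      ring
    rw [this] at hsum
    rw [show π ^ 3 / 16 = 2 * (π ^ 3 / 32) by ring, ← hsum.unique h2]
    refine setIntegral_congr_fun measurableSet_Ioo fun t ht => ?_
    have hlt : |-(t ^ 2)| < 1 := by
      rw [abs_neg, abs_of_nonneg (sq_nonneg t)]
      nlinarith [ht.1, ht.2]
    have hg := (hasSum_geometric_of_abs_lt_one hlt).mul_right (log t ^ 2)
    have hg' : HasSum (fun k : ℕ => (-1 : ℝ) ^ k * (t ^ (2 * k) * log t ^ 2))
        (log t ^ 2 / (1 + t ^ 2)) := by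
      rw [show log t ^ 2 / (1 + t ^ 2) = (1 - -t ^ 2)⁻¹ * log t ^ 2 by
        rw [sub_neg_eq_add]
        ring]
      refine hg.congr_fun fun k => ?_
      rw [neg_pow, pow_mul]
      ring
    exact hg'.tsum_eq.symm
  · have hs := hasSum_neg_one_pow_div_odd_cube.summable.norm.mul_left 2
    refine hs.congr fun k => ?_
    have : ∀ t ∈ Set.Ioo (0 : ℝ) 1, ‖(-1 : ℝ) ^ k * (t ^ (2 * k) * log t ^ 2)‖
        = t ^ (2 * k) * log t ^ 2 := fun t ht => by
      rw [norm_mul, norm_pow, norm_neg, norm_one, one_pow, one_mul, norm_of_nonneg]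
      exact mul_nonneg (pow_nonneg ht.1.le _) (sq_nonneg _)
    rw [setIntegral_congr_fun measurableSet_Ioo this, hval, norm_div, norm_pow, norm_neg, norm_one,
      one_pow, norm_of_nonneg (by positivity)]
    ring

lemma image_tan_Ioo_zero_pi_div_four : tan '' Set.Ioo 0 (π / 4) = Set.Ioo 0 1 := by
  ext t
  constructor
  · rintro ⟨x, hx, rfl⟩
    have h1 := tan_pos_of_pos_of_lt_pi_div_two hx.1 (by linarith [hx.2, pi_pos])
    refine ⟨h1, ?_⟩
    rw [← tan_pi_div_four]
    exact tan_lt_tan_of_nonneg_of_lt_pi_div_two hx.1.le (by linarith [pi_pos]) hx.2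
  · intro ht
    refine ⟨arctan t, ⟨arctan_pos.2 ht.1, ?_⟩, tan_arctan t⟩
    rw [← arctan_one]
    exact arctan_strictMono ht.2

lemma integrableOn_and_integral_log_tan_sq_left :
    IntegrableOn (fun x : ℝ => log (tan x) ^ 2) (Set.Ioo 0 (π / 4)) ∧
      ∫ x in Set.Ioo 0 (π / 4), log (tan x) ^ 2 = π ^ 3 / 16 := by
  have hcos : ∀ x ∈ Set.Ioo 0 (π / 4), 0 < cos x := fun x hx =>
    cos_pos_of_mem_Ioo ⟨by linarith [hx.1, pi_pos], by linarith [hx.2, pi_pos]⟩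
  have hd : ∀ x ∈ Set.Ioo 0 (π / 4),
      HasDerivWithinAt tan (1 / cos x ^ 2) (Set.Ioo 0 (π / 4)) x := fun x hx =>
    (hasDerivAt_tan (hcos x hx).ne').hasDerivWithinAt
  have hinj : Set.InjOn tan (Set.Ioo 0 (π / 4)) := injOn_tan.mono
    (Set.Ioo_subset_Ioo (by linarith [pi_pos]) (by linarith [pi_pos]))
  have hcongr : ∀ x ∈ Set.Ioo 0 (π / 4),
      |1 / cos x ^ 2| • (log (tan x) ^ 2 / (1 + tan x ^ 2)) = log (tan x) ^ 2 := fun x hx => by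
    have h := (hcos x hx).ne'
    rw [abs_of_nonneg (by positivity), smul_eq_mul, one_div, ← inv_one_add_tan_sq h, inv_inv]
    have : 1 + tan x ^ 2 ≠ 0 := by positivity
    field_simp
  have h1 := integrableOn_image_iff_integrableOn_abs_deriv_smul measurableSet_Ioo hd hinj
    (fun t : ℝ => log t ^ 2 / (1 + t ^ 2))
  have h2 := integral_image_eq_integral_abs_deriv_smul measurableSet_Ioo hd hinj
    (fun t : ℝ => log t ^ 2 / (1 + t ^ 2))
  rw [image_tan_Ioo_zero_pi_div_four] at h1 h2
  rw [integrableOn_congr_fun hcongr measurableSet_Ioo] at h1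
  rw [setIntegral_congr_fun measurableSet_Ioo hcongr, integral_log_sq_div] at h2
  exact ⟨h1.1 integrableOn_log_sq_div, h2.symm⟩

lemma log_tan_pi_div_two_sub (x : ℝ) : log (tan (π / 2 - x)) = -log (tan x) := by
  rw [tan_pi_div_two_sub, log_inv]

lemma intervalIntegrable_and_integral_log_tan_sq :
    IntervalIntegrable (fun x : ℝ => log (tan x) ^ 2) volume 0 (π / 2) ∧
      ∫ x in (0 : ℝ)..(π / 2), log (tan x) ^ 2 = π ^ 3 / 8 := by
  obtain ⟨h1, h2⟩ := integrableOn_and_integral_log_tan_sq_left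
  have hpi : (0 : ℝ) ≤ π / 4 := by positivity
  rw [← integrableOn_Ioc_iff_integrableOn_Ioo,
    ← intervalIntegrable_iff_integrableOn_Ioc_of_le hpi] at h1
  rw [← integral_Ioc_eq_integral_Ioo, ← intervalIntegral.integral_of_le hpi] at h2
  -- Reflection carries the left half of the interval onto the right half.
  have h3 := h1.comp_sub_left (π / 2)
  have h4 := intervalIntegral.integral_comp_sub_left (a := 0) (b := π / 4)
    (fun x : ℝ => log (tan x) ^ 2) (π / 2)
  simp only [log_tan_pi_div_two_sub, neg_sq, sub_zero] at h3 h4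
  rw [show π / 2 - π / 4 = π / 4 by ring] at h3 h4
  refine ⟨h1.trans h3.symm, ?_⟩
  rw [← intervalIntegral.integral_add_adjacent_intervals h1 h3.symm, ← h4, h2]
  ring

lemma memLp_log_tan : MemLp (fun x : ℝ => log (tan x)) 2 halfPiMeasure := by
  have hm : Measurable fun x : ℝ => log (tan x) := by
    have : Measurable tan := by
      have : tan = fun x => sin x / cos x := funext tan_eq_sin_div_cos
      rw [this]
      fun_prop
    fun_prop
  rw [memLp_two_iff_integrable_sq hm.aestronglyMeasurable, halfPiMeasure, ← IntegrableOn,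
    ← integrableOn_Ioc_iff_integrableOn_Ioo,
    ← intervalIntegrable_iff_integrableOn_Ioc_of_le (by positivity)]
  exact intervalIntegrable_and_integral_log_tan_sq.1

/-! ### Integration by parts for polynomials. -/

namespace Polynomial

lemma integral_mul_derivative (p q : ℝ[X]) (a b : ℝ) :
    ∫ x in a..b, p.eval x * (derivative q).eval x =
      p.eval b * q.eval b - p.eval a * q.eval a -
        ∫ x in a..b, (derivative p).eval x * q.eval x :=
  intervalIntegral.integral_mul_deriv_eq_deriv_mul (fun x _ => p.hasDerivAt x)
    (fun x _ => q.hasDerivAt x) ((derivative p).continuous.intervalIntegrable _ _)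
    ((derivative q).continuous.intervalIntegrable _ _)

lemma integral_mul_iterate_derivative (n : ℕ) (p q : ℝ[X]) (a b : ℝ)
    (ha : ∀ k < n, (derivative^[k] q).eval a = 0) (hb : ∀ k < n, (derivative^[k] q).eval b = 0) :
    ∫ x in a..b, p.eval x * (derivative^[n] q).eval x =
      (-1) ^ n * ∫ x in a..b, (derivative^[n] p).eval x * q.eval x := by
  induction n generalizing p with
  | zero => simp
  | succ n ih =>
    rw [Function.iterate_succ_apply' derivative n q, integral_mul_derivative, ha n n.lt_succ_self,
      hb n n.lt_succ_self, ih _ (fun k hk => ha k (hk.trans n.lt_succ_self))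
      (fun k hk => hb k (hk.trans n.lt_succ_self)), Function.iterate_succ_apply]
    ring

/-- Euler's beta integral at integer arguments. -/
lemma integral_pow_mul_sub_pow (a : ℝ) (m k : ℕ) :
    ∫ x in (0 : ℝ)..a, x ^ k * (a - x) ^ m = k ! * m ! / (k + m + 1)! * a ^ (k + m + 1) := by
  induction m generalizing k with
  | zero =>
    simp only [pow_zero, mul_one, integral_pow, add_zero, Nat.factorial_zero, Nat.cast_one]
    rw [Nat.factorial_succ]
    have : (k ! : ℝ) ≠ 0 := by positivity
    push_cast
    field_simp
    ring
  | succ m ih =>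
    -- Integrating `x ^ k` by parts moves one unit of exponent from `a - x` to `x`.
    have h := integral_mul_derivative ((C a - X) ^ (m + 1)) (C (((k : ℝ) + 1)⁻¹) * X ^ (k + 1)) 0 a
    have hk : (k : ℝ) + 1 ≠ 0 := by positivity
    have e1 (x : ℝ) : eval x ((C a - X) ^ (m + 1)) *
        eval x (derivative (C (((k : ℝ) + 1)⁻¹) * X ^ (k + 1))) = x ^ k * (a - x) ^ (m + 1) := by
      simp
      field_simp
    have e2 (x : ℝ) : eval x (derivative ((C a - X) ^ (m + 1))) *
        eval x (C (((k : ℝ) + 1)⁻¹) * X ^ (k + 1)) =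
        (-((m + 1) / (k + 1)) : ℝ) * (x ^ (k + 1) * (a - x) ^ m) := by
      simp [derivative_pow]
      field_simp
    simp only [e1, e2] at h
    rw [h, intervalIntegral.integral_const_mul, ih]
    rw [show k + 1 + m + 1 = k + (m + 1) + 1 by ring, Nat.factorial_succ k, Nat.factorial_succ m]
    have : ((k + (m + 1) + 1)! : ℝ) ≠ 0 := by positivity
    simp
    field_simp

lemma iterate_derivative_comp_C_sub_X (a : ℝ) (n : ℕ) (p : ℝ[X]) :
    derivative^[n] (p.comp (C a - X)) = C ((-1 : ℝ) ^ n) * (derivative^[n] p).comp (C a - X) := by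
  induction n with
  | zero => simp
  | succ n ih =>
    rw [Function.iterate_succ_apply', ih, Function.iterate_succ_apply', derivative_C_mul,
      derivative_comp]
    simp [pow_succ]

end Polynomial

/-! ### Shifted Legendre polynomials: degree, orthogonality, norm, parity. -/

open Polynomial

/-- The polynomial `x ^ n * (π / 2 - x) ^ n` of the Rodrigues formula. -/
noncomputable def rodriguesBase (n : ℕ) : ℝ[X] := X ^ n * (C (π / 2) - X) ^ n

/-- The normalizing factor of the Rodrigues formula. -/
noncomputable def rodriguesCoeff (n : ℕ) : ℝ := (-1 : ℝ) ^ n / (n ! : ℝ) * (2 / π) ^ n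

lemma legendreHalfPi_eq (n : ℕ) :
    legendreHalfPi n = C (rodriguesCoeff n) * derivative^[n] (rodriguesBase n) := rfl

lemma rodriguesCoeff_ne_zero (n : ℕ) : rodriguesCoeff n ≠ 0 := by
  unfold rodriguesCoeff
  have := pi_pos
  positivity

lemma natDegree_C_sub_X (a : ℝ) : (C a - X : ℝ[X]).natDegree = 1 := by
  rw [← neg_sub, natDegree_neg, natDegree_X_sub_C]

lemma natDegree_rodriguesBase (n : ℕ) : (rodriguesBase n).natDegree = 2 * n := by
  have h0 : (C (π / 2) - X : ℝ[X]) ≠ 0 := fun h => by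
    have := natDegree_C_sub_X (π / 2)
    simp [h] at this
  rw [rodriguesBase, natDegree_mul (pow_ne_zero _ X_ne_zero) (pow_ne_zero _ h0), natDegree_pow,
    natDegree_pow, natDegree_X, natDegree_C_sub_X]
  ring

lemma leadingCoeff_rodriguesBase (n : ℕ) : (rodriguesBase n).leadingCoeff = (-1) ^ n := by
  have h : (C (π / 2) - X : ℝ[X]).leadingCoeff = -1 := by
    rw [← neg_sub, leadingCoeff_neg, leadingCoeff_X_sub_C]
  simp [rodriguesBase, leadingCoeff_mul, leadingCoeff_pow, h]

lemma iterate_derivative_two_mul_rodriguesBase (n : ℕ) :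
    derivative^[2 * n] (rodriguesBase n) = C ((2 * n)! * (-1 : ℝ) ^ n) := by
  have h0 : (derivative^[2 * n] (rodriguesBase n)).natDegree = 0 := by
    have := natDegree_iterate_derivative (rodriguesBase n) (2 * n)
    rw [natDegree_rodriguesBase] at this
    omega
  rw [eq_C_of_natDegree_eq_zero h0, coeff_iterate_derivative, zero_add, Nat.descFactorial_self,
    nsmul_eq_mul, ← leadingCoeff_rodriguesBase, leadingCoeff, natDegree_rodriguesBase]

lemma degree_legendreHalfPi (n : ℕ) : (legendreHalfPi n).degree = n := by
  refine le_antisymm ?_ ?_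
  · rw [legendreHalfPi_eq]
    refine degree_le_of_natDegree_le ((natDegree_C_mul_le _ _).trans ?_)
    have := natDegree_iterate_derivative (rodriguesBase n) n
    rw [natDegree_rodriguesBase] at this
    omega
  · refine le_degree_of_ne_zero ?_
    rw [legendreHalfPi_eq, coeff_C_mul, coeff_iterate_derivative, ← two_mul]
    refine mul_ne_zero (rodriguesCoeff_ne_zero n) ?_
    have := leadingCoeff_rodriguesBase n
    rw [leadingCoeff, natDegree_rodriguesBase] at this
    rw [this, nsmul_eq_mul]
    refine mul_ne_zero (Nat.cast_ne_zero.2 ?_) (by positivity)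
    rw [Ne, Nat.descFactorial_eq_zero_iff_lt]
    omega

lemma span_range_legendreHalfPi : Submodule.span ℝ (Set.range legendreHalfPi) = ⊤ :=
  Polynomial.Sequence.span ⟨legendreHalfPi, degree_legendreHalfPi⟩ fun n => by
    refine isUnit_iff_ne_zero.2 (leadingCoeff_ne_zero.2 fun h => ?_)
    have h' : legendreHalfPi n = 0 := h
    have := degree_legendreHalfPi n
    simp [h'] at this

lemma eval_iterate_derivative_eq_zero {p q : ℝ[X]} {n k : ℕ} {x : ℝ} (hk : k < n)
    (hdvd : q ^ n ∣ p) (hq : q.eval x = 0) : (derivative^[k] p).eval x = 0 := by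
  obtain ⟨r, hr⟩ := pow_sub_dvd_iterate_derivative_of_pow_dvd k hdvd
  rw [hr, eval_mul, eval_pow, hq, zero_pow (by omega), zero_mul]

/-- The Rodrigues base vanishes to order `n` at both endpoints, so integrating by parts `n` times
leaves no boundary terms. -/
lemma integral_mul_legendreHalfPi (n : ℕ) (p : ℝ[X]) :
    ∫ x in (0 : ℝ)..(π / 2), p.eval x * (legendreHalfPi n).eval x =
      rodriguesCoeff n * ((-1) ^ n *
        ∫ x in (0 : ℝ)..(π / 2), (derivative^[n] p).eval x * (rodriguesBase n).eval x) := by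
  rw [← integral_mul_iterate_derivative n p (rodriguesBase n) 0 (π / 2)
    (fun k hk => eval_iterate_derivative_eq_zero (q := X) hk (dvd_mul_right _ _) (by simp))
    (fun k hk => eval_iterate_derivative_eq_zero (q := C (π / 2) - X) hk (dvd_mul_left _ _)
      (by simp)),
    ← intervalIntegral.integral_const_mul]
  congr 1
  ext x
  rw [legendreHalfPi_eq, eval_C_mul]
  ring

lemma integral_legendreFun_mul_of_lt {m n : ℕ} (h : m < n) :
    ∫ x in (0 : ℝ)..(π / 2), legendreFun m x * legendreFun n x = 0 := by
  have := integral_mul_legendreHalfPi n (legendreHalfPi m)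
  rw [iterate_derivative_eq_zero
    (by rwa [natDegree_eq_of_degree_eq_some (degree_legendreHalfPi m)])] at this
  simpa [legendreFun] using this

lemma integral_legendreFun_mul_of_ne {m n : ℕ} (h : m ≠ n) :
    ∫ x in (0 : ℝ)..(π / 2), legendreFun m x * legendreFun n x = 0 := by
  rcases h.lt_or_gt with h | h
  · exact integral_legendreFun_mul_of_lt h
  · simpa only [mul_comm] using integral_legendreFun_mul_of_lt h

lemma integral_legendreFun_mul_self (n : ℕ) :
    ∫ x in (0 : ℝ)..(π / 2), legendreFun n x * legendreFun n x = π / 2 / (2 * n + 1) := by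
  have h := integral_mul_legendreHalfPi n (legendreHalfPi n)
  have hd : derivative^[n] (legendreHalfPi n) =
      C (rodriguesCoeff n * ((2 * n)! * (-1 : ℝ) ^ n)) := by
    rw [legendreHalfPi_eq, iterate_derivative_C_mul, ← Function.iterate_add_apply, ← two_mul,
      iterate_derivative_two_mul_rodriguesBase, ← C_mul]
  have he : ∀ x : ℝ, (rodriguesBase n).eval x = x ^ n * (π / 2 - x) ^ n := fun x => by
    simp [rodriguesBase]
  simp only [hd, eval_C, he] at h
  rw [intervalIntegral.integral_const_mul, integral_pow_mul_sub_pow] at h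
  refine h.trans ?_
  have h1 : ((-1 : ℝ) ^ n) * (-1) ^ n = 1 := by rw [← mul_pow]; simp
  have h2 : (2 / π) ^ n * (π / 2) ^ n = 1 := by
    rw [← mul_pow, div_mul_div_cancel₀ pi_ne_zero, div_self two_ne_zero, one_pow]
  rw [← two_mul, Nat.factorial_succ, pow_succ (π / 2), pow_mul', rodriguesCoeff]
  have hn : (n ! : ℝ) ≠ 0 := by positivity
  have hn2 : ((2 * n)! : ℝ) ≠ 0 := by positivity
  have hn3 : (2 * (n : ℝ) + 1) ≠ 0 := by positivity
  push_cast
  -- The powers become atoms, and only `s * s = 1` and `u * v = 1` are used about them.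
  generalize (-1 : ℝ) ^ n = s at *
  generalize (2 / π) ^ n = u at *
  generalize (π / 2) ^ n = v at *
  have : s / n ! * u * (s * (s / n ! * u * ((2 * n)! * s) *
      (n ! * n ! / ((2 * n + 1) * (2 * n)!) * (v ^ 2 * (π / 2))))) =
      (s * s) ^ 2 * (u * v) ^ 2 * (π / 2 / (2 * n + 1)) := by
    field_simp
  rw [this, h1, h2]
  ring

lemma legendreFun_pi_div_two_sub (n : ℕ) (x : ℝ) :
    legendreFun n (π / 2 - x) = (-1) ^ n * legendreFun n x := by
  have h := iterate_derivative_comp_C_sub_X (π / 2) n (rodriguesBase n)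
  have hs : (rodriguesBase n).comp (C (π / 2) - X) = rodriguesBase n := by
    simp [rodriguesBase, mul_comm]
  rw [hs] at h
  have h' := congrArg (eval x) h
  simp only [eval_mul, eval_C, eval_comp, eval_sub, eval_X] at h'
  have h1 : ((-1 : ℝ) ^ n) * (-1) ^ n = 1 := by rw [← mul_pow]; simp
  simp only [legendreFun, legendreHalfPi_eq, eval_C_mul]
  rw [h']
  linear_combination (-(rodriguesCoeff n * eval (π / 2 - x) (derivative^[n] (rodriguesBase n)))) * h1

/-! ### Completeness and the Hilbert basis. -/

instance : IsFiniteMeasure halfPiMeasure := by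
  unfold halfPiMeasure
  infer_instance

lemma memLp_eval (p : ℝ[X]) : MemLp (fun x => p.eval x) 2 halfPiMeasure := by
  obtain ⟨c, hc⟩ := isCompact_Icc.exists_bound_of_continuousOn
    (p.continuous.continuousOn (s := Set.Icc 0 (π / 2)))
  refine MemLp.of_bound p.continuous.aestronglyMeasurable c ?_
  exact (ae_restrict_iff' measurableSet_Ioo).2
    (Filter.Eventually.of_forall fun x hx => hc x (Set.Ioo_subset_Icc_self hx))

/-- The linear map taking a polynomial to its class in `L²(0, π/2)`. -/
noncomputable def polynomialToLp : ℝ[X] →ₗ[ℝ] Lp ℝ 2 halfPiMeasure where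
  toFun p := (memLp_eval p).toLp _
  map_add' p q := by
    rw [← MemLp.toLp_add]
    congr 1
    ext x
    simp
  map_smul' c p := by
    rw [RingHom.id_apply, ← MemLp.toLp_const_smul]
    congr 1
    ext x
    simp

lemma denseRange_polynomialToLp : DenseRange polynomialToLp := by
  have : halfPiMeasure.WeaklyRegular := by
    unfold halfPiMeasure
    infer_instance
  refine dense_closure.1 (Dense.mono ?_
    (BoundedContinuousFunction.toLp_denseRange (E := ℝ) (p := 2) halfPiMeasure ℝ (by simp)))
  rintro _ ⟨g, rfl⟩
  rw [Metric.mem_closure_iff]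
  intro ε hε
  set M : ℝ := (measureUnivNNReal halfPiMeasure : ℝ) ^ (2 : ENNReal).toReal⁻¹ with hM
  have hM0 : 0 ≤ M := by positivity
  -- The `L²` norm is at most `M` times the sup norm; dividing by `M + 1` makes the final bound
  -- strictly less than `ε`.
  obtain ⟨p, hp⟩ := exists_polynomial_near_of_continuousOn 0 (π / 2) g g.continuous.continuousOn
    (ε / (M + 1)) (by positivity)
  refine ⟨_, ⟨p, rfl⟩, ?_⟩
  rw [dist_comm, dist_eq_norm]
  have hb : ‖polynomialToLp p - BoundedContinuousFunction.toLp 2 halfPiMeasure ℝ g‖ ≤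
      M * (ε / (M + 1)) := by
    refine Lp.norm_le_of_ae_bound (by positivity) ?_
    have hx : ∀ᵐ x ∂halfPiMeasure, x ∈ Set.Ioo 0 (π / 2) := ae_restrict_mem measurableSet_Ioo
    filter_upwards [hx, Lp.coeFn_sub (polynomialToLp p)
      (BoundedContinuousFunction.toLp 2 halfPiMeasure ℝ g), (memLp_eval p).coeFn_toLp,
      BoundedContinuousFunction.coeFn_toLp halfPiMeasure (p := 2) ℝ g] with x hx h1 h2 h3
    rw [h1, Pi.sub_apply, h3]
    refine (le_of_eq ?_).trans (hp x (Set.Ioo_subset_Icc_self hx)).le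
    rw [Real.norm_eq_abs]
    exact congrArg (fun y => |y - g x|) h2
  refine hb.trans_lt ?_
  rw [mul_div_assoc', div_lt_iff₀ (by positivity)]
  nlinarith

lemma integral_halfPiMeasure (f : ℝ → ℝ) :
    ∫ x, f x ∂halfPiMeasure = ∫ x in (0 : ℝ)..(π / 2), f x := by
  rw [intervalIntegral.integral_of_le (by positivity), integral_Ioc_eq_integral_Ioo, halfPiMeasure]

lemma inner_toLp {f g : ℝ → ℝ} (hf : MemLp f 2 halfPiMeasure) (hg : MemLp g 2 halfPiMeasure) :
    inner ℝ (hf.toLp f) (hg.toLp g) = ∫ x in (0 : ℝ)..(π / 2), f x * g x := by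
  rw [L2.inner_def, ← integral_halfPiMeasure]
  refine integral_congr_ae ?_
  filter_upwards [hf.coeFn_toLp, hg.coeFn_toLp] with x h1 h2
  rw [h1, h2]
  simp [mul_comm]

lemma memLp_legendreFun (n : ℕ) : MemLp (legendreFun n) 2 halfPiMeasure :=
  memLp_eval (legendreHalfPi n)

/-- The normalizing factor that makes the Legendre polynomials orthonormal in `L²(0, π/2)`. -/
noncomputable def legendreNormFactor (n : ℕ) : ℝ := √(2 / π * (2 * n + 1))

lemma legendreNormFactor_mul_self (n : ℕ) :
    legendreNormFactor n * legendreNormFactor n = 2 / π * (2 * n + 1) :=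
  mul_self_sqrt (by positivity)

lemma legendreNormFactor_ne_zero (n : ℕ) : legendreNormFactor n ≠ 0 :=
  (sqrt_pos.2 (by positivity)).ne'

/-- The normalized Legendre polynomials in `L²(0, π/2)`. -/
noncomputable def legendreLp (n : ℕ) : Lp ℝ 2 halfPiMeasure :=
  legendreNormFactor n • (memLp_legendreFun n).toLp (legendreFun n)

lemma orthonormal_legendreLp : Orthonormal ℝ legendreLp := by
  rw [orthonormal_iff_ite]
  intro m n
  rw [legendreLp, legendreLp, real_inner_smul_left, real_inner_smul_right, inner_toLp]
  split_ifs with h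
  · subst h
    rw [integral_legendreFun_mul_self, ← mul_assoc, legendreNormFactor_mul_self]
    have : (2 * (m : ℝ) + 1) ≠ 0 := by positivity
    have := pi_ne_zero
    field_simp
  · rw [integral_legendreFun_mul_of_ne h, mul_zero, mul_zero]

lemma topologicalClosure_span_legendreLp :
    ⊤ ≤ (Submodule.span ℝ (Set.range legendreLp)).topologicalClosure := by
  have h : LinearMap.range polynomialToLp ≤ Submodule.span ℝ (Set.range legendreLp) := by
    rw [LinearMap.range_eq_map, ← span_range_legendreHalfPi, Submodule.map_span, Submodule.span_le]
    rintro _ ⟨_, ⟨n, rfl⟩, rfl⟩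
    have : polynomialToLp (legendreHalfPi n) = (legendreNormFactor n)⁻¹ • legendreLp n := by
      rw [legendreLp, inv_smul_smul₀ (legendreNormFactor_ne_zero n)]
      rfl
    rw [this]
    exact Submodule.smul_mem _ _ (Submodule.subset_span ⟨n, rfl⟩)
  intro f _
  exact closure_mono h (denseRange_polynomialToLp f)

/-- The normalized Legendre polynomials as a Hilbert basis of `L²(0, π/2)`. -/
noncomputable def legendreBasis : HilbertBasis ℕ ℝ (Lp ℝ 2 halfPiMeasure) :=
  HilbertBasis.mk orthonormal_legendreLp topologicalClosure_span_legendreLp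

lemma legendreBasis_apply (n : ℕ) : legendreBasis n = legendreLp n :=
  congrFun (HilbertBasis.coe_mk orthonormal_legendreLp topologicalClosure_span_legendreLp) n

/-! ### Coefficients and conclusion. -/

lemma inner_legendreLp_log_tan (n : ℕ) :
    inner ℝ (legendreLp n) (memLp_log_tan.toLp _) =
      legendreNormFactor n * logTanIntegral (legendreFun n) := by
  rw [legendreLp, real_inner_smul_left, inner_toLp, logTanIntegral]

lemma logTanIntegral_legendreFun_of_even {n : ℕ} (hn : Even n) :
    logTanIntegral (legendreFun n) = 0 := by
  have h := intervalIntegral.integral_comp_sub_left (a := 0) (b := π / 2)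
    (fun x : ℝ => legendreFun n x * log (tan x)) (π / 2)
  simp only [log_tan_pi_div_two_sub, legendreFun_pi_div_two_sub, hn.neg_one_pow, one_mul, mul_neg,
    intervalIntegral.integral_neg, sub_self, sub_zero] at h
  rw [logTanIntegral]
  linarith

/-- In `ℕ`, `2 * (n + 1) - 1 = 2n + 1` runs through the odd numbers, and unconditional sums ignore
zero terms. -/
lemma hasSum_odd_iff {E : Type*} [AddCommMonoid E] [TopologicalSpace E] {f : ℕ → E} {a : E}
    (hf : ∀ n, Even n → f n = 0) : HasSum (fun n => f (2 * (n + 1) - 1)) a ↔ HasSum f a := by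
  have hinj : Function.Injective (fun n : ℕ => 2 * (n + 1) - 1) := fun a b h => by
    simp only at h
    omega
  refine hinj.hasSum_iff fun n hn => hf n ?_
  by_contra ho
  obtain ⟨k, hk⟩ := Nat.not_even_iff_odd.1 ho
  exact hn ⟨k, by simp only; omega⟩

lemma cast_two_mul_odd_add_one (n : ℕ) :
    2 * ((2 * (n + 1) - 1 : ℕ) : ℝ) + 1 = 4 * ((n + 1 : ℕ) : ℝ) - 1 := by
  rw [show 2 * (n + 1) - 1 = 2 * n + 1 by omega]
  push_cast
  ring

/-- The index `n : ℕ` stands for the summation index `n + 1 ≥ 1`. -/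
theorem mainTheorem6 :
    (∃ (hf : MemLp (fun x : ℝ => Real.log (Real.tan x)) 2 halfPiMeasure)
       (hP : ∀ n : ℕ, MemLp (legendreFun n) 2 halfPiMeasure),
      HasSum
        (fun n : ℕ =>
          (2 / π * ((4 * ((n + 1 : ℕ) : ℝ) - 1) *
              logTanIntegral (legendreFun (2 * (n + 1) - 1)))) •
            (hP (2 * (n + 1) - 1)).toLp (legendreFun (2 * (n + 1) - 1)))
        (hf.toLp (fun x : ℝ => Real.log (Real.tan x)))) ∧
    HasSum
      (fun n : ℕ =>
        (4 * ((n + 1 : ℕ) : ℝ) - 1) * logTanIntegral (legendreFun (2 * (n + 1) - 1)) ^ 2)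
      ((π / 2) ^ 4) := by
  refine ⟨⟨memLp_log_tan, memLp_legendreFun, ?_⟩, ?_⟩
  · have h := legendreBasis.hasSum_repr (memLp_log_tan.toLp _)
    simp only [HilbertBasis.repr_apply_apply, legendreBasis_apply, inner_legendreLp_log_tan] at h
    rw [← hasSum_odd_iff fun n hn => by
      rw [logTanIntegral_legendreFun_of_even hn, mul_zero, zero_smul]] at h
    refine h.congr_fun fun n => ?_
    rw [legendreLp, smul_smul, mul_right_comm, legendreNormFactor_mul_self,
      cast_two_mul_odd_add_one, mul_assoc]
  · have h := legendreBasis.hasSum_inner_mul_inner (memLp_log_tan.toLp _) (memLp_log_tan.toLp _)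
    have hsq : inner ℝ (memLp_log_tan.toLp _) (memLp_log_tan.toLp _) = π ^ 3 / 8 := by
      rw [inner_toLp, ← intervalIntegrable_and_integral_log_tan_sq.2]
      simp only [sq]
    simp only [legendreBasis_apply, real_inner_comm (legendreLp _), inner_legendreLp_log_tan,
      hsq] at h
    rw [← hasSum_odd_iff fun n hn => by
      rw [logTanIntegral_legendreFun_of_even hn, mul_zero, zero_mul]] at h
    -- The factor `π / 2` cancels the `2 / π` in the squared normalizing factor.
    have h' := h.mul_left (π / 2)
    rw [show π / 2 * (π ^ 3 / 8) = (π / 2) ^ 4 by ring] at h'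
    refine h'.congr_fun fun n => ?_
    rw [mul_mul_mul_comm, legendreNormFactor_mul_self, cast_two_mul_odd_add_one]
    have := pi_ne_zero
    field_simp
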